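/- Let $V$ be a finite set and let $G'=(V,F)$ be a chordal graph (every cycle of length at least $4$ has a chord). Let $C_1,\dots,C_l\subseteq V$ be the maximal cliques of $G'$, each listed exactly once, in an order with the running intersection property: for every $r=1,\dots,l-1$ there is $s\ge r+1$ with $U_r\subsetneq C_s$, where $U_r := C_r\cap(C_{r+1}\cup\cdots\cup C_l)$. Let $\bar X$ be a real partial symmetric matrix indexed by $V\times V$ whose specified entries are exactly the diagonal entries and the entries $\bar X_{ij}=\bar X_{ji}$ with $\{i,j\}\in F$, and suppose that the principal submatrix $\bar X_{C_rC_r}$ is positive definite for every $r=1,\dots,l$. A positive definite completion of $\bar X$ is a symmetric positive definite matrix that agrees with $\bar X$ at all specified entries. Then among the positive definite completions of $\bar X$ there is exactly one, $\hat X$, whose determinant is maximal, and $$\ln\det\hat X=\sum_{r=1}^{l}\ln\det\bar X_{C_rC_r}-\sum_{r=1}^{l-1}\ln\det\bar X_{U_rU_r}$$ (the determinant of an empty matrix being $1$). -/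

import Mathlib

namespace MatrixCompletion

/-- A graph is chordal if every cycle of length at least four has a chord, i.e. an edge of the graph
joining two vertices of the cycle that are not consecutive on it. -/
def IsChordal {V : Type*} (G : SimpleGraph V) : Prop :=
  ∀ (v : V) (p : G.Walk v v), p.IsCycle → 4 ≤ p.length →
    ∃ x ∈ p.support, ∃ y ∈ p.support, G.Adj x y ∧ s(x, y) ∉ p.edges

/-- The separator `U r = C r ∩ (C (r+1) ∪ ⋯ ∪ C l)` of a finite sequence of vertex sets
(the last one is empty). -/
def separator {V : Type*} [DecidableEq V] {l : ℕ} (C : Fin l → Finset V) (r : Fin l) : Finset V :=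
  C r ∩ (Finset.Ioi r).biUnion C

/-- `C` lists all maximal cliques of `G`, each exactly once, in an order that has the running
intersection property: every `U r` other than the last is a proper subset of some later `C s`. -/
structure IsRunningIntersectionOrdering {V : Type*} [DecidableEq V] (G : SimpleGraph V) {l : ℕ}
    (C : Fin l → Finset V) : Prop where
  injective : Function.Injective C
  mem_iff : ∀ K : Finset V, (∃ r, C r = K) ↔ Maximal G.IsClique (K : Set V)
  running : ∀ r : Fin l, (r : ℕ) + 1 < l → ∃ s, r < s ∧ separator C r ⊂ C s

theorem IsRunningIntersectionOrdering.isClique {V : Type*} [DecidableEq V] {G : SimpleGraph V}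
    {l : ℕ} {C : Fin l → Finset V} (h : IsRunningIntersectionOrdering G C) (r : Fin l) :
    G.IsClique (C r : Set V) :=
  ((h.mem_iff (C r)).1 ⟨r, rfl⟩).prop

theorem IsRunningIntersectionOrdering.isClique_separator {V : Type*} [DecidableEq V]
    {G : SimpleGraph V} {l : ℕ} {C : Fin l → Finset V} (h : IsRunningIntersectionOrdering G C)
    (r : Fin l) : G.IsClique (separator C r : Set V) :=
  (h.isClique r).subset (Finset.coe_subset.2 Finset.inter_subset_left)

/-- A partial real symmetric matrix with pattern `G`: exactly the diagonal entries and the entries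
at the edges of `G` are specified. -/
structure PartialSymMatrix {V : Type*} (G : SimpleGraph V) where
  entry : ∀ i j : V, i = j ∨ G.Adj i j → ℝ
  symm : ∀ (i j : V) (h : i = j ∨ G.Adj i j) (h' : j = i ∨ G.Adj j i), entry i j h = entry j i h'

namespace PartialSymMatrix

/-- The principal submatrix indexed by a clique; all of its entries are specified. -/
def block {V : Type*} {G : SimpleGraph V} (A : PartialSymMatrix G) (K : Finset V)
    (hK : G.IsClique (K : Set V)) : Matrix K K ℝ :=
  Matrix.of fun i j => A.entry i j
    ((em ((i : V) = j)).imp_right fun hij => hK i.2 j.2 hij)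

/-- `X` is a completion: it agrees with the partial matrix at every specified entry. -/
def IsCompletion {V : Type*} {G : SimpleGraph V} (A : PartialSymMatrix G)
    (X : Matrix V V ℝ) : Prop :=
  ∀ (i j : V) (h : i = j ∨ G.Adj i j), X i j = A.entry i j h

/-- `X` is a (symmetric) positive definite completion. -/
def IsPosDefCompletion {V : Type*} {G : SimpleGraph V} (A : PartialSymMatrix G)
    (X : Matrix V V ℝ) : Prop :=
  A.IsCompletion X ∧ X.PosDef

/-- `X` is a positive definite completion whose determinant is maximal among all of them. -/
def IsMaxDetCompletion {V : Type*} [Fintype V] [DecidableEq V] {G : SimpleGraph V}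
    (A : PartialSymMatrix G) (X : Matrix V V ℝ) : Prop :=
  A.IsPosDefCompletion X ∧ ∀ Y : Matrix V V ℝ, A.IsPosDefCompletion Y → Y.det ≤ X.det

end PartialSymMatrix

end MatrixCompletion

/-! Koteljanskii's inequality `det M[K ∪ L] * det M[K ∩ L] ≤ det M[K] * det M[L]` for positive
definite `M` is Fischer's inequality for the Schur complement of `M[K ∩ L]`, and equality holds
exactly when the block of this Schur complement between `K \ L` and `L \ K` vanishes. Applied to
`C 0` and `C 1 ∪ ⋯ ∪ C (l - 1)`, then recursively to the remaining cliques, it bounds the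
determinant of every positive definite completion by the quotient of the clique and separator
determinants, a quantity depending on the specified entries only.

In the equality case the vanishing of the Schur complement blocks determines the unspecified entries
one clique at a time, which gives uniqueness. Conversely, gluing the cliques together one at a time,
with the unspecified entries chosen so that these blocks vanish, gives a completion attaining the
bound; the running intersection property makes the new clique agree with the matrix built so far on
their intersection. -/

namespace MatrixCompletion

open Matrix
open scoped ComplexOrder

variable {α 𝕜 : Type*} [RCLike 𝕜]

section Fischer

variable {m n : Type*} [Fintype m] [DecidableEq m] [Fintype n] [DecidableEq n]

theorem det_eq_ofReal_prod_eigenvalues {M : Matrix n n 𝕜} (hM : M.IsHermitian) :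
    M.det = ((∏ i, hM.eigenvalues i : ℝ) : 𝕜) := by
  rw [hM.det_eq_prod_eigenvalues, RCLike.ofReal_prod]

theorem sum_eigenvalues_sub_one_nonpos {M : Matrix n n 𝕜} (hM : M.IsHermitian)
    (htr : M.trace ≤ Fintype.card n) : ∑ i, (hM.eigenvalues i - 1) ≤ 0 := by
  rw [hM.trace_eq_sum_eigenvalues] at htr
  have : ∑ i, hM.eigenvalues i ≤ Fintype.card n := by exact_mod_cast htr
  simpa using this

theorem eq_one_of_eigenvalues_eq_one {M : Matrix n n 𝕜} (hM : M.IsHermitian)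
    (h : ∀ i, hM.eigenvalues i = 1) : M = 1 := by
  have hdiag : diagonal ((RCLike.ofReal : ℝ → 𝕜) ∘ hM.eigenvalues) = 1 := by
    simp [h, ← diagonal_one]
  rw [hM.spectral_theorem, hdiag, map_one]

theorem det_le_one_of_trace_le_card {M : Matrix n n 𝕜} (hM : M.PosDef)
    (htr : M.trace ≤ Fintype.card n) : M.det ≤ 1 := by
  have hle : ∏ i, hM.1.eigenvalues i ≤ 1 := by
    rw [← Real.log_nonpos_iff (Finset.prod_pos fun i _ => hM.eigenvalues_pos i).le,
      Real.log_prod fun i _ => (hM.eigenvalues_pos i).ne']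
    exact (Finset.sum_le_sum fun i _ => Real.log_le_sub_one_of_pos (hM.eigenvalues_pos i)).trans
      (sum_eigenvalues_sub_one_nonpos hM.1 htr)
  rw [det_eq_ofReal_prod_eigenvalues hM.1]
  exact_mod_cast hle

theorem eq_one_of_trace_le_card_of_det_eq_one {M : Matrix n n 𝕜} (hM : M.PosDef)
    (htr : M.trace ≤ Fintype.card n) (hdet : M.det = 1) : M = 1 := by
  have hprod : ∏ i, hM.1.eigenvalues i = 1 := by
    rw [det_eq_ofReal_prod_eigenvalues hM.1] at hdet
    exact_mod_cast hdet
  have hsum : ∑ i, Real.log (hM.1.eigenvalues i) = 0 := by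
    rw [← Real.log_prod fun i _ => (hM.eigenvalues_pos i).ne', hprod, Real.log_one]
  refine eq_one_of_eigenvalues_eq_one hM.1 fun i => ?_
  by_contra hi
  have hlt : ∑ i, Real.log (hM.1.eigenvalues i) < ∑ i, (hM.1.eigenvalues i - 1) :=
    Finset.sum_lt_sum (fun j _ => Real.log_le_sub_one_of_pos (hM.eigenvalues_pos j))
      ⟨i, Finset.mem_univ i, Real.log_lt_sub_one_of_pos (hM.eigenvalues_pos i) hi⟩
  exact (hsum ▸ hlt).not_ge (sum_eigenvalues_sub_one_nonpos hM.1 htr)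

open scoped MatrixOrder Matrix.Norms.L2Operator in
theorem exists_isUnit_mul_mul_conjTranspose_eq_one {X : Matrix n n 𝕜} (hX : X.PosDef) :
    ∃ B : Matrix n n 𝕜, IsUnit B ∧ B * X * Bᴴ = 1 ∧ Bᴴ * B = X⁻¹ := by
  obtain ⟨B, hB⟩ := CStarAlgebra.nonneg_iff_eq_star_mul_self.mp hX.inv.posSemidef.nonneg
  rw [star_eq_conjTranspose] at hB
  have hinv : Bᴴ * (B * X) = 1 := by
    rw [← mul_assoc, ← hB, nonsing_inv_mul _ hX.det_pos.ne'.isUnit]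
  have hconj : B * X * Bᴴ = 1 := mul_eq_one_comm.1 hinv
  exact ⟨B, .of_mul_eq_one (X * Bᴴ) (by rw [← mul_assoc, hconj]), hconj, hB.symm⟩

theorem det_le_det_of_trace_inv_mul_le_card {X Y : Matrix n n 𝕜} (hX : X.PosDef) (hY : Y.PosDef)
    (htr : (X⁻¹ * Y).trace ≤ Fintype.card n) : Y.det ≤ X.det ∧ (Y.det = X.det → Y = X) := by
  obtain ⟨B, hBu, hBX, hB⟩ := exists_isUnit_mul_mul_conjTranspose_eq_one hX
  have hBY : (B * Y * Bᴴ).PosDef :=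
    hY.mul_mul_conjTranspose_same (vecMul_injective_of_isUnit hBu)
  rw [← hB, mul_assoc, trace_mul_comm] at htr
  have hdet : (B * Y * Bᴴ).det * X.det = Y.det := by
    have := congrArg det hBX
    simp only [det_mul, det_one] at this ⊢
    linear_combination Y.det * this
  refine ⟨?_, fun h => ?_⟩
  · rw [← hdet]
    exact mul_le_of_le_one_left hX.det_pos.le (det_le_one_of_trace_le_card hBY htr)
  · have hBY_det : (B * Y * Bᴴ).det = 1 :=
      mul_right_cancel₀ hX.det_pos.ne' (by rw [hdet, h, one_mul])
    have hBYX : B * Y * Bᴴ = B * X * Bᴴ := by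
      rw [hBX, eq_one_of_trace_le_card_of_det_eq_one hBY htr hBY_det]
    exact hBu.mul_left_cancel (hBu.star.mul_right_cancel hBYX)

omit [Fintype n] [DecidableEq n] in
theorem posDef_fromBlocks_iff [Finite n] {A : Matrix m m 𝕜} (hA : A.PosDef) (B : Matrix m n 𝕜)
    (D : Matrix n n 𝕜) : (fromBlocks A B Bᴴ D).PosDef ↔ (D - Bᴴ * A⁻¹ * B).PosDef := by
  classical
  have := Fintype.ofFinite n
  have : Invertible A := invertibleOfIsUnitDet A hA.det_pos.ne'.isUnit
  have hpsd := PosDef.fromBlocks₁₁ B D hA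
  have hdet : (fromBlocks A B Bᴴ D).det ≠ 0 ↔ (D - Bᴴ * A⁻¹ * B).det ≠ 0 := by
    simp [det_fromBlocks₁₁, hA.det_pos.ne']
  constructor <;> intro h
  · exact (hpsd.1 h.posSemidef).posDef_iff_det_ne_zero.2 (hdet.1 h.det_pos.ne')
  · exact (hpsd.2 h.posSemidef).posDef_iff_det_ne_zero.2 (hdet.2 h.det_pos.ne')

omit [Fintype m] [DecidableEq m] [Fintype n] [DecidableEq n] in
theorem posDef_fromBlocks_zero [Finite m] [Finite n] {A : Matrix m m 𝕜} {D : Matrix n n 𝕜}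
    (hA : A.PosDef) (hD : D.PosDef) : (fromBlocks A 0 0 D).PosDef := by
  classical
  have := Fintype.ofFinite m
  simpa using (posDef_fromBlocks_iff hA 0 D).2 (by simpa using hD)

theorem fischer_inequality {A : Matrix m m 𝕜} {B : Matrix m n 𝕜} {D : Matrix n n 𝕜}
    (h : (fromBlocks A B Bᴴ D).PosDef) :
    (fromBlocks A B Bᴴ D).det ≤ A.det * D.det ∧
      ((fromBlocks A B Bᴴ D).det = A.det * D.det ↔ B = 0) := by
  have hA : A.PosDef := h.submatrix Sum.inl_injective
  have hD : D.PosDef := h.submatrix Sum.inr_injective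
  have hinv : (fromBlocks A 0 0 D)⁻¹ = fromBlocks A⁻¹ 0 0 D⁻¹ := by
    refine inv_eq_right_inv ?_
    simp [fromBlocks_multiply, mul_nonsing_inv _ hA.det_pos.ne'.isUnit,
      mul_nonsing_inv _ hD.det_pos.ne'.isUnit]
  have htr : ((fromBlocks A 0 0 D)⁻¹ * fromBlocks A B Bᴴ D).trace ≤ Fintype.card (m ⊕ n) := by
    simp [hinv, fromBlocks_multiply, trace, nonsing_inv_mul _ hA.det_pos.ne'.isUnit,
      nonsing_inv_mul _ hD.det_pos.ne'.isUnit]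
  have key := det_le_det_of_trace_inv_mul_le_card (posDef_fromBlocks_zero hA hD) h htr
  rw [det_fromBlocks_zero₂₁] at key
  refine ⟨key.1, fun heq => (fromBlocks_inj.1 (key.2 heq)).2.1, ?_⟩
  rintro rfl
  exact det_fromBlocks_zero₁₂ A _ D

end Fischer

section Principal

variable {V : Type*}

/-- The principal submatrix `M[K]`, indexed by the subtype `K` like the specified blocks
`PartialSymMatrix.block`. -/
def principal (M : Matrix V V α) (K : Finset V) : Matrix K K α :=
  M.submatrix (↑) (↑)

theorem principal_eq_principal_iff {M N : Matrix V V α} {K : Finset V} :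
    principal M K = principal N K ↔ ∀ i ∈ K, ∀ j ∈ K, M i j = N i j := by
  simp [← Matrix.ext_iff, principal]

theorem principal_eq_principal_of_subset {M N : Matrix V V α} {K L : Finset V}
    (h : L ⊆ K) (hK : principal M K = principal N K) : principal M L = principal N L := by
  rw [principal_eq_principal_iff] at hK ⊢
  exact fun i hi j hj => hK i (h hi) j (h hj)

theorem posDef_principal {M : Matrix V V 𝕜} (hM : M.PosDef) (K : Finset V) :
    (principal M K).PosDef :=
  hM.submatrix Subtype.val_injective

theorem posDef_principal_of_subset {M : Matrix V V 𝕜} {K L : Finset V} (h : L ⊆ K)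
    (hK : (principal M K).PosDef) : (principal M L).PosDef :=
  hK.submatrix (Set.inclusion_injective h)

theorem posDef_of_posDef_principal_univ [Fintype V] {M : Matrix V V 𝕜}
    (hM : (principal M Finset.univ).PosDef) : M.PosDef :=
  hM.submatrix (e := fun i => ⟨i, Finset.mem_univ i⟩) fun _ _ => congrArg Subtype.val

theorem eq_of_principal_univ_eq [Fintype V] {M N : Matrix V V α}
    (h : principal M Finset.univ = principal N Finset.univ) : M = N :=
  Matrix.ext fun i j => principal_eq_principal_iff.1 h i (Finset.mem_univ i) j (Finset.mem_univ j)

theorem submatrix_val_eq_zero_iff [Zero α] {M : Matrix V V α} {K L : Finset V} :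
    M.submatrix ((↑) : K → V) ((↑) : L → V) = 0 ↔ ∀ i ∈ K, ∀ j ∈ L, M i j = 0 := by
  simp [← Matrix.ext_iff]

variable [DecidableEq V]

theorem det_principal_univ [CommRing α] [Fintype V] (M : Matrix V V α) :
    (principal M Finset.univ).det = M.det :=
  det_submatrix_equiv_self (Equiv.subtypeUnivEquiv Finset.mem_univ) M

theorem principal_union_submatrix [CommRing α] [StarRing α] {M : Matrix V V α} (hM : M.IsHermitian)
    {K L : Finset V} (h : Disjoint K L) :
    (principal M (K ∪ L)).submatrix (Equiv.Finset.union K L h) (Equiv.Finset.union K L h) =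
      fromBlocks (principal M K) (M.submatrix (↑) (↑)) (M.submatrix (↑) (↑))ᴴ (principal M L) := by
  rw [conjTranspose_submatrix, hM.eq]
  ext (i | i) (j | j) <;> rfl

theorem posDef_principal_union_iff {M : Matrix V V 𝕜} (hM : M.IsHermitian) {K L : Finset V}
    (h : Disjoint K L) : (principal M (K ∪ L)).PosDef ↔
      (fromBlocks (principal M K) (M.submatrix (↑) (↑)) (M.submatrix (↑) (↑))ᴴ
        (principal M L)).PosDef := by
  rw [← principal_union_submatrix hM h]
  exact ⟨fun hp => hp.submatrix (Equiv.injective _), fun hp => by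
    simpa using hp.submatrix (Equiv.Finset.union K L h).symm.injective⟩

theorem det_principal_union [CommRing α] [StarRing α] {M : Matrix V V α} (hM : M.IsHermitian)
    {K L : Finset V} (h : Disjoint K L) : (principal M (K ∪ L)).det =
      (fromBlocks (principal M K) (M.submatrix (↑) (↑)) (M.submatrix (↑) (↑))ᴴ
        (principal M L)).det := by
  rw [← principal_union_submatrix hM h, det_submatrix_equiv_self]

theorem det_principal_union_le_and_eq_iff {M : Matrix V V 𝕜} (hM : M.IsHermitian)
    {K L : Finset V} (h : Disjoint K L) (hKL : (principal M (K ∪ L)).PosDef) :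
    (principal M (K ∪ L)).det ≤ (principal M K).det * (principal M L).det ∧
      ((principal M (K ∪ L)).det = (principal M K).det * (principal M L).det ↔
        ∀ i ∈ K, ∀ j ∈ L, M i j = 0) := by
  rw [posDef_principal_union_iff hM h] at hKL
  rw [det_principal_union hM h, ← submatrix_val_eq_zero_iff]
  exact fischer_inequality hKL

theorem posDef_principal_union_of_apply_eq_zero {M : Matrix V V 𝕜} (hM : M.IsHermitian)
    {K L : Finset V} (h : Disjoint K L) (hK : (principal M K).PosDef)
    (hL : (principal M L).PosDef) (hzero : ∀ i ∈ K, ∀ j ∈ L, M i j = 0) :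
    (principal M (K ∪ L)).PosDef := by
  rw [posDef_principal_union_iff hM h, submatrix_val_eq_zero_iff.2 hzero, conjTranspose_zero]
  exact posDef_fromBlocks_zero hK hL

end Principal

section SchurComplement

variable {V : Type*} [DecidableEq V]

/-- The Schur complement `M - M[V,U] * M[U]⁻¹ * M[U,V]`. It is indexed by all of `V` rather than by
`Uᶜ`, so that Schur complements with respect to `U` of different principal submatrices containing
`M[U]` are principal submatrices of one and the same matrix. -/
noncomputable def schurComplement [CommRing α] (M : Matrix V V α) (U : Finset V) : Matrix V V α :=
  M - M.submatrix id ((↑) : U → V) * (principal M U)⁻¹ * M.submatrix ((↑) : U → V) id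

theorem isHermitian_schurComplement [CommRing α] [StarRing α] {M : Matrix V V α}
    (hM : M.IsHermitian) (U : Finset V) : (schurComplement M U).IsHermitian := by
  have hinv : (principal M U)⁻¹.IsHermitian := (hM.submatrix _).inv
  have hcol : M.submatrix id ((↑) : U → V) = (M.submatrix ((↑) : U → V) id)ᴴ := by
    rw [conjTranspose_submatrix, hM.eq]
  rw [schurComplement, hcol]
  exact hM.sub (isHermitian_conjTranspose_mul_mul _ hinv)

theorem principal_schurComplement [CommRing α] [StarRing α] {M : Matrix V V α} (hM : M.IsHermitian)
    (U T : Finset V) :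
    principal (schurComplement M U) T =
      principal M T - (M.submatrix ((↑) : U → V) ((↑) : T → V))ᴴ * (principal M U)⁻¹ *
        M.submatrix ((↑) : U → V) ((↑) : T → V) := by
  rw [conjTranspose_submatrix, hM.eq]
  rfl

theorem sub_schurComplement_apply_congr [CommRing α] {M N : Matrix V V α} {U : Finset V} {i j : V}
    (hU : principal M U = principal N U) (hi : ∀ u ∈ U, M i u = N i u)
    (hj : ∀ u ∈ U, M u j = N u j) :
    M i j - schurComplement M U i j = N i j - schurComplement N U i j := by
  simp only [schurComplement, Matrix.sub_apply, sub_sub_cancel, Matrix.mul_apply, submatrix_apply,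
    id, hU, hi _ (Subtype.prop _), hj _ (Subtype.prop _)]

theorem det_principal_eq_mul_det_schurComplement {M : Matrix V V 𝕜} (hM : M.IsHermitian)
    {U T : Finset V} (hUT : U ⊆ T) (hU : (principal M U).PosDef) :
    (principal M T).det =
      (principal M U).det * (principal (schurComplement M U) (T \ U)).det := by
  have : Invertible (principal M U) := invertibleOfIsUnitDet _ hU.det_pos.ne'.isUnit
  conv_lhs => rw [← Finset.union_sdiff_of_subset hUT]
  rw [det_principal_union hM Finset.disjoint_sdiff, det_fromBlocks₁₁, invOf_eq_nonsing_inv,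
    principal_schurComplement hM]

theorem posDef_principal_iff_schurComplement {M : Matrix V V 𝕜} (hM : M.IsHermitian)
    {U T : Finset V} (hUT : U ⊆ T) (hU : (principal M U).PosDef) :
    (principal M T).PosDef ↔ (principal (schurComplement M U) (T \ U)).PosDef := by
  conv_lhs => rw [← Finset.union_sdiff_of_subset hUT]
  rw [posDef_principal_union_iff hM Finset.disjoint_sdiff, posDef_fromBlocks_iff hU,
    principal_schurComplement hM]

theorem union_sdiff_inter (K L : Finset V) : (K ∪ L) \ (K ∩ L) = K \ L ∪ L \ K := by
  grind

theorem koteljanskii_inequality {M : Matrix V V 𝕜} (hM : M.IsHermitian) {K L : Finset V}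
    (hKL : (principal M (K ∪ L)).PosDef) :
    (principal M (K ∪ L)).det * (principal M (K ∩ L)).det ≤
        (principal M K).det * (principal M L).det ∧
      ((principal M (K ∪ L)).det * (principal M (K ∩ L)).det =
          (principal M K).det * (principal M L).det ↔
        ∀ i ∈ K \ L, ∀ j ∈ L \ K, schurComplement M (K ∩ L) i j = 0) := by
  have hUKL : K ∩ L ⊆ K ∪ L := Finset.inter_subset_union
  have hU : (principal M (K ∩ L)).PosDef := posDef_principal_of_subset hUKL hKL
  have hS : (principal (schurComplement M (K ∩ L)) (K \ L ∪ L \ K)).PosDef := by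
    rwa [← union_sdiff_inter, ← posDef_principal_iff_schurComplement hM hUKL hU]
  have hfischer := det_principal_union_le_and_eq_iff (isHermitian_schurComplement hM (K ∩ L))
    disjoint_sdiff_sdiff hS
  have hd : 0 < (principal M (K ∩ L)).det ^ 2 := pow_pos hU.det_pos 2
  have hleft : (principal M (K ∪ L)).det * (principal M (K ∩ L)).det =
      (principal M (K ∩ L)).det ^ 2 *
        (principal (schurComplement M (K ∩ L)) (K \ L ∪ L \ K)).det := by
    rw [det_principal_eq_mul_det_schurComplement hM hUKL hU, union_sdiff_inter]
    ring
  have hright : (principal M K).det * (principal M L).det =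
      (principal M (K ∩ L)).det ^ 2 * ((principal (schurComplement M (K ∩ L)) (K \ L)).det *
        (principal (schurComplement M (K ∩ L)) (L \ K)).det) := by
    rw [det_principal_eq_mul_det_schurComplement hM Finset.inter_subset_left hU,
      det_principal_eq_mul_det_schurComplement hM Finset.inter_subset_right hU,
      Finset.sdiff_inter_self_left, Finset.sdiff_inter_self_right]
    ring
  rw [hleft, hright, mul_right_inj' hd.ne']
  exact ⟨mul_le_mul_of_nonneg_left hfischer.1 hd.le, hfischer.2⟩

end SchurComplement

section Gluing

variable {V : Type*} [DecidableEq V]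

/-- The matrix obtained from `M` by changing its entries between `K \ L` and `L \ K` so that the
corresponding entries of the Schur complement with respect to `K ∩ L` vanish; in terms of Gaussian
vectors, the coordinates in `K` and `L` become conditionally independent given those in `K ∩ L`. -/
noncomputable def decouple [CommRing α] (M : Matrix V V α) (K L : Finset V) : Matrix V V α :=
  of fun i j => if (i ∈ K \ L ∧ j ∈ L \ K) ∨ (i ∈ L \ K ∧ j ∈ K \ L) then
    M i j - schurComplement M (K ∩ L) i j else M i j

theorem isHermitian_decouple [CommRing α] [StarRing α] {M : Matrix V V α} (hM : M.IsHermitian)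
    (K L : Finset V) : (decouple M K L).IsHermitian := by
  have hS := isHermitian_schurComplement hM (K ∩ L)
  refine .ext fun i j => ?_
  simp only [decouple, of_apply, apply_ite star, star_sub, hM.apply, hS.apply]
  exact if_congr (by tauto) rfl rfl

theorem decouple_apply_of_mem_left [CommRing α] (M : Matrix V V α) {K L : Finset V} {i j : V}
    (hi : i ∈ K) (hj : j ∈ K) : decouple M K L i j = M i j := by
  simp [decouple, hi, hj]

theorem decouple_apply_of_mem_right [CommRing α] (M : Matrix V V α) {K L : Finset V} {i j : V}
    (hi : i ∈ L) (hj : j ∈ L) : decouple M K L i j = M i j := by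
  simp [decouple, hi, hj]

theorem principal_decouple_left [CommRing α] (M : Matrix V V α) (K L : Finset V) :
    principal (decouple M K L) K = principal M K :=
  principal_eq_principal_iff.2 fun _ hi _ hj => decouple_apply_of_mem_left M hi hj

theorem principal_decouple_right [CommRing α] (M : Matrix V V α) (K L : Finset V) :
    principal (decouple M K L) L = principal M L :=
  principal_eq_principal_iff.2 fun _ hi _ hj => decouple_apply_of_mem_right M hi hj

theorem principal_decouple_inter [CommRing α] (M : Matrix V V α) (K L : Finset V) :
    principal (decouple M K L) (K ∩ L) = principal M (K ∩ L) :=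
  principal_eq_principal_of_subset Finset.inter_subset_left (principal_decouple_left M K L)

theorem schurComplement_decouple_apply_eq_zero [CommRing α] (M : Matrix V V α) {K L : Finset V}
    {i j : V} (hi : i ∈ K \ L) (hj : j ∈ L \ K) :
    schurComplement (decouple M K L) (K ∩ L) i j = 0 := by
  have hsub := sub_schurComplement_apply_congr (i := i) (j := j) (principal_decouple_inter M K L)
    (fun u hu => decouple_apply_of_mem_left M (Finset.mem_sdiff.1 hi).1 (Finset.mem_inter.1 hu).1)
    (fun u hu => decouple_apply_of_mem_right M (Finset.mem_inter.1 hu).2 (Finset.mem_sdiff.1 hj).1)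
  have hij : decouple M K L i j = M i j - schurComplement M (K ∩ L) i j :=
    if_pos (.inl ⟨hi, hj⟩)
  rwa [← hij, sub_eq_self] at hsub

theorem posDef_principal_decouple_union {M : Matrix V V 𝕜} (hM : M.IsHermitian) {K L : Finset V}
    (hK : (principal M K).PosDef) (hL : (principal M L).PosDef) :
    (principal (decouple M K L) (K ∪ L)).PosDef := by
  have hD := isHermitian_decouple hM K L
  have hU : (principal (decouple M K L) (K ∩ L)).PosDef := by
    rw [principal_decouple_inter]
    exact posDef_principal_of_subset Finset.inter_subset_left hK
  rw [← principal_decouple_left M K L,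
    posDef_principal_iff_schurComplement hD Finset.inter_subset_left hU,
    Finset.sdiff_inter_self_left] at hK
  rw [← principal_decouple_right M K L,
    posDef_principal_iff_schurComplement hD Finset.inter_subset_right hU,
    Finset.sdiff_inter_self_right] at hL
  rw [posDef_principal_iff_schurComplement hD Finset.inter_subset_union hU, union_sdiff_inter]
  exact posDef_principal_union_of_apply_eq_zero (isHermitian_schurComplement hD _)
    disjoint_sdiff_sdiff hK hL fun i hi j hj => schurComplement_decouple_apply_eq_zero M hi hj

theorem det_principal_decouple_union {M : Matrix V V 𝕜} (hM : M.IsHermitian) {K L : Finset V}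
    (hK : (principal M K).PosDef) (hL : (principal M L).PosDef) :
    (principal (decouple M K L) (K ∪ L)).det * (principal M (K ∩ L)).det =
      (principal M K).det * (principal M L).det := by
  have heq := (koteljanskii_inequality (isHermitian_decouple hM K L)
    (posDef_principal_decouple_union hM hK hL)).2.2
      fun i hi j hj => schurComplement_decouple_apply_eq_zero M hi hj
  rwa [principal_decouple_left, principal_decouple_right, principal_decouple_inter] at heq

theorem exists_principal_eq_principal_eq [Star α] {M N : Matrix V V α} (hM : M.IsHermitian)
    (hN : N.IsHermitian) {K L : Finset V} (h : principal M (K ∩ L) = principal N (K ∩ L)) :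
    ∃ P : Matrix V V α, P.IsHermitian ∧ principal P K = principal M K ∧
      principal P L = principal N L := by
  refine ⟨of fun i j => if i ∈ K ∧ j ∈ K then M i j else N i j, .ext fun i j => ?_, ?_, ?_⟩
  · simp only [of_apply, apply_ite star, hM.apply, hN.apply, and_comm]
  · exact principal_eq_principal_iff.2 fun i hi j hj => if_pos ⟨hi, hj⟩
  · rw [principal_eq_principal_iff] at h ⊢
    intro i hi j hj
    rw [of_apply, ite_eq_right_iff]
    exact fun hK => h i (Finset.mem_inter.2 ⟨hK.1, hi⟩) j (Finset.mem_inter.2 ⟨hK.2, hj⟩)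

theorem principal_union_eq_of_koteljanskii_eq {M N : Matrix V V 𝕜} (hM : M.PosDef) (hN : N.PosDef)
    {K L : Finset V} (hK : principal M K = principal N K) (hL : principal M L = principal N L)
    (hMdet : (principal M (K ∪ L)).det * (principal M (K ∩ L)).det =
      (principal M K).det * (principal M L).det)
    (hNdet : (principal N (K ∪ L)).det * (principal N (K ∩ L)).det =
      (principal N K).det * (principal N L).det) :
    principal M (K ∪ L) = principal N (K ∪ L) := by
  have hU := principal_eq_principal_of_subset (Finset.inter_subset_left (s₂ := L)) hK
  rw [principal_eq_principal_iff] at hK hL ⊢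
  rw [(koteljanskii_inequality hM.1 (posDef_principal hM _)).2] at hMdet
  rw [(koteljanskii_inequality hN.1 (posDef_principal hN _)).2] at hNdet
  have hoff : ∀ i ∈ K \ L, ∀ j ∈ L \ K, M i j = N i j := by
    intro i hi j hj
    have hsub := sub_schurComplement_apply_congr (i := i) (j := j) hU
      (fun u hu => hK i (Finset.mem_sdiff.1 hi).1 u (Finset.mem_inter.1 hu).1)
      (fun u hu => hL u (Finset.mem_inter.1 hu).2 j (Finset.mem_sdiff.1 hj).1)
    rwa [hMdet i hi j hj, hNdet i hi j hj, sub_zero, sub_zero] at hsub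
  intro i hi j hj
  have hoff' : i ∈ L \ K → j ∈ K \ L → M i j = N i j := fun hi hj => by
    rw [← hM.1.apply, ← hN.1.apply, hoff j hj i hi]
  grind

end Gluing

section CliqueSequence

variable {V : Type*} [DecidableEq V]

theorem biUnion_univ_succ {l : ℕ} (C : Fin (l + 1) → Finset V) :
    Finset.univ.biUnion C = C 0 ∪ Finset.univ.biUnion (Fin.tail C) := by
  ext i
  simp [Fin.exists_fin_succ, Fin.tail]

theorem mem_separator {l : ℕ} {C : Fin l → Finset V} {r : Fin l} {i : V} :
    i ∈ separator C r ↔ i ∈ C r ∧ ∃ s, r < s ∧ i ∈ C s := by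
  simp [separator]

theorem separator_subset {l : ℕ} (C : Fin l → Finset V) (r : Fin l) : separator C r ⊆ C r :=
  Finset.inter_subset_left

theorem separator_zero {l : ℕ} (C : Fin (l + 1) → Finset V) :
    separator C 0 = C 0 ∩ Finset.univ.biUnion (Fin.tail C) := by
  ext i
  simp [mem_separator, Fin.exists_fin_succ, Fin.tail]

theorem separator_succ {l : ℕ} (C : Fin (l + 1) → Finset V) (r : Fin l) :
    separator C r.succ = separator (Fin.tail C) r := by
  ext i
  simp [mem_separator, Fin.exists_fin_succ, Fin.tail]

theorem separator_eq_empty_of_last {l : ℕ} (C : Fin l → Finset V) {r : Fin l}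
    (hr : ¬(r : ℕ) + 1 < l) : separator C r = ∅ := by
  refine Finset.eq_empty_of_forall_notMem fun i hi => ?_
  obtain ⟨-, s, hrs, -⟩ := mem_separator.1 hi
  omega

theorem prod_det_separator_succ [CommRing α] {l : ℕ} (M : Matrix V V α)
    (C : Fin (l + 1) → Finset V) :
    ∏ r, (principal M (separator C r)).det =
      (principal M (C 0 ∩ Finset.univ.biUnion (Fin.tail C))).det *
        ∏ r, (principal M (separator (Fin.tail C) r)).det := by
  rw [Fin.prod_univ_succ, separator_zero]
  have hsucc (r : Fin l) : (principal M (separator C r.succ)).det =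
      (principal M (separator (Fin.tail C) r)).det := by rw [separator_succ]
  simp only [hsucc]

theorem det_principal_of_eq_empty [CommRing α] (M : Matrix V V α) {K : Finset V} (hK : K = ∅) :
    (principal M K).det = 1 := by
  subst hK
  exact det_isEmpty

omit [DecidableEq V] in
theorem posDef_principal_of_eq_empty {M : Matrix V V 𝕜} (hM : M.IsHermitian) {K : Finset V}
    (hK : K = ∅) : (principal M K).PosDef := by
  subst hK
  exact ⟨hM.submatrix _, fun x hx => (hx (Subsingleton.elim x 0)).elim⟩

theorem prod_det_pos {ι : Type*} [Fintype ι] {M : Matrix V V 𝕜} (hM : M.PosDef)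
    (C : ι → Finset V) : 0 < ∏ r, (principal M (C r)).det :=
  Finset.prod_pos fun r _ => (posDef_principal hM (C r)).det_pos

theorem det_biUnion_mul_prod_det_separator_le {l : ℕ} (C : Fin l → Finset V) {M : Matrix V V 𝕜}
    (hM : M.PosDef) : (principal M (Finset.univ.biUnion C)).det *
      ∏ r, (principal M (separator C r)).det ≤ ∏ r, (principal M (C r)).det := by
  induction l with
  | zero => simp [det_principal_of_eq_empty]
  | succ l ih =>
    rw [prod_det_separator_succ, biUnion_univ_succ, Fin.prod_univ_succ, ← mul_assoc]
    refine (mul_le_mul_of_nonneg_right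
      (koteljanskii_inequality hM.1 (posDef_principal hM _)).1 (prod_det_pos hM _).le).trans ?_
    rw [mul_assoc]
    exact mul_le_mul_of_nonneg_left (ih (Fin.tail C)) (posDef_principal hM _).det_pos.le

/-- Equality in `det_biUnion_mul_prod_det_separator_le`: the determinant of `M` on the union of a
sequence of vertex sets is the product of its determinants on the sets divided by the product of
its determinants on the separators. -/
def DetFactorizes [CommRing α] {l : ℕ} (M : Matrix V V α) (C : Fin l → Finset V) : Prop :=
  (principal M (Finset.univ.biUnion C)).det * ∏ r, (principal M (separator C r)).det =
    ∏ r, (principal M (C r)).det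

theorem DetFactorizes.of_principal_biUnion_eq [CommRing α] {l : ℕ} {M N : Matrix V V α}
    {C : Fin l → Finset V} (hN : DetFactorizes N C)
    (h : principal M (Finset.univ.biUnion C) = principal N (Finset.univ.biUnion C)) :
    DetFactorizes M C := by
  have hC (r : Fin l) : C r ⊆ Finset.univ.biUnion C := Finset.subset_biUnion_of_mem C (by simp)
  have hset (r : Fin l) := principal_eq_principal_of_subset (hC r) h
  have hsep (r : Fin l) := principal_eq_principal_of_subset (separator_subset C r) (hset r)
  simpa only [DetFactorizes, h, hset, hsep] using hN

theorem DetFactorizes.of_tail [CommRing α] {l : ℕ} {M : Matrix V V α} {C : Fin (l + 1) → Finset V}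
    (htail : DetFactorizes M (Fin.tail C))
    (hunion : (principal M (C 0 ∪ Finset.univ.biUnion (Fin.tail C))).det *
        (principal M (C 0 ∩ Finset.univ.biUnion (Fin.tail C))).det =
      (principal M (C 0)).det * (principal M (Finset.univ.biUnion (Fin.tail C))).det) :
    DetFactorizes M C := by
  rw [DetFactorizes, prod_det_separator_succ, biUnion_univ_succ, Fin.prod_univ_succ, ← mul_assoc,
    hunion, mul_assoc, htail]
  rfl

theorem DetFactorizes.koteljanskii_eq_and_tail {l : ℕ} {M : Matrix V V 𝕜} (hM : M.PosDef)
    {C : Fin (l + 1) → Finset V} (h : DetFactorizes M C) :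
    (principal M (C 0 ∪ Finset.univ.biUnion (Fin.tail C))).det *
          (principal M (C 0 ∩ Finset.univ.biUnion (Fin.tail C))).det =
        (principal M (C 0)).det * (principal M (Finset.univ.biUnion (Fin.tail C))).det ∧
      DetFactorizes M (Fin.tail C) := by
  set U := Finset.univ.biUnion (Fin.tail C) with hU
  have hkot := (koteljanskii_inequality hM.1 (posDef_principal hM (C 0 ∪ U))).1
  have htail := det_biUnion_mul_prod_det_separator_le (Fin.tail C) hM
  have hsep := prod_det_pos hM (separator (Fin.tail C))
  have hC0 := (posDef_principal hM (C 0)).det_pos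
  rw [DetFactorizes, prod_det_separator_succ, biUnion_univ_succ, Fin.prod_univ_succ, ← hU,
    ← mul_assoc] at h
  have hC0U : (principal M (C 0)).det * (principal M U).det ≤
      (principal M (C 0 ∪ U)).det * (principal M (C 0 ∩ U)).det := by
    refine le_of_mul_le_mul_right ?_ hsep
    rw [h, mul_assoc]
    exact mul_le_mul_of_nonneg_left htail hC0.le
  have hprod : ∏ r, (principal M (C (Fin.succ r))).det ≤
      (principal M U).det * ∏ r, (principal M (separator (Fin.tail C) r)).det := by
    refine le_of_mul_le_mul_left ?_ hC0
    rw [← h, ← mul_assoc]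
    exact mul_le_mul_of_nonneg_right hkot hsep.le
  exact ⟨hkot.antisymm hC0U, htail.antisymm hprod⟩

theorem DetFactorizes.principal_biUnion_eq {l : ℕ} {M N : Matrix V V 𝕜} (hM : M.PosDef)
    (hN : N.PosDef) {C : Fin l → Finset V} (hMC : DetFactorizes M C) (hNC : DetFactorizes N C)
    (h : ∀ r, principal M (C r) = principal N (C r)) :
    principal M (Finset.univ.biUnion C) = principal N (Finset.univ.biUnion C) := by
  induction l with
  | zero => exact principal_eq_principal_iff.2 (by simp)
  | succ l ih =>
    obtain ⟨hMeq, hMtail⟩ := hMC.koteljanskii_eq_and_tail hM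
    obtain ⟨hNeq, hNtail⟩ := hNC.koteljanskii_eq_and_tail hN
    rw [biUnion_univ_succ]
    exact principal_union_eq_of_koteljanskii_eq hM hN (h 0)
      (ih hMtail hNtail fun r => h r.succ) hMeq hNeq

theorem exists_separator_subset_tail {l : ℕ} {C : Fin (l + 1) → Finset V}
    (h : ∀ r : Fin (l + 1), (r : ℕ) + 1 < l + 1 → ∃ s, r < s ∧ separator C r ⊆ C s) (r : Fin l)
    (hr : (r : ℕ) + 1 < l) : ∃ s, r < s ∧ separator (Fin.tail C) r ⊆ Fin.tail C s := by
  obtain ⟨s, hrs, hs⟩ := h r.succ (by simpa using hr)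
  obtain ⟨t, rfl⟩ := Fin.exists_succ_eq.2 (Fin.ne_zero_of_lt hrs)
  exact ⟨t, Fin.succ_lt_succ_iff.1 hrs, by rwa [← separator_succ]⟩

theorem principal_inter_biUnion_tail_eq {l : ℕ} {C : Fin (l + 1) → Finset V}
    {M N : Matrix V V α} (hrun : 0 < l → ∃ s, 0 < s ∧ separator C 0 ⊆ C s)
    (h : ∀ r, principal M (Fin.tail C r) = principal N (Fin.tail C r)) :
    principal M (C 0 ∩ Finset.univ.biUnion (Fin.tail C)) =
      principal N (C 0 ∩ Finset.univ.biUnion (Fin.tail C)) := by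
  rw [← separator_zero]
  rcases l.eq_zero_or_pos with rfl | hl
  · exact principal_eq_principal_iff.2 (by simp [separator_eq_empty_of_last])
  · obtain ⟨s, hs0, hs⟩ := hrun hl
    obtain ⟨t, rfl⟩ := Fin.exists_succ_eq.2 hs0.ne'
    exact principal_eq_principal_of_subset hs (h t)

theorem exists_posDef_principal_biUnion_detFactorizes {l : ℕ} (C : Fin l → Finset V)
    {M : Matrix V V 𝕜} (hM : M.IsHermitian) (hC : ∀ r, (principal M (C r)).PosDef)
    (hrun : ∀ r : Fin l, (r : ℕ) + 1 < l → ∃ s, r < s ∧ separator C r ⊆ C s) :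
    ∃ X : Matrix V V 𝕜, X.IsHermitian ∧ (∀ r, principal X (C r) = principal M (C r)) ∧
      (principal X (Finset.univ.biUnion C)).PosDef ∧ DetFactorizes X C := by
  induction l with
  | zero =>
    refine ⟨M, hM, finZeroElim, posDef_principal_of_eq_empty hM (by simp), ?_⟩
    simp [DetFactorizes, det_principal_of_eq_empty]
  | succ l ih =>
    set U := Finset.univ.biUnion (Fin.tail C)
    obtain ⟨N, hN, hNC, hNU, hNfac⟩ := ih (Fin.tail C) (fun r => hC r.succ)
      (exists_separator_subset_tail hrun)
    obtain ⟨P, hP, hP0, hPU⟩ := exists_principal_eq_principal_eq hM hN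
      (principal_inter_biUnion_tail_eq (fun hl => hrun 0 (by simpa using hl))
        fun r => (hNC r).symm)
    have hP0_posDef : (principal P (C 0)).PosDef := hP0 ▸ hC 0
    have hPU_posDef : (principal P U).PosDef := hPU ▸ hNU
    have hX0 := (principal_decouple_left P (C 0) U).trans hP0
    have hXU := (principal_decouple_right P (C 0) U).trans hPU
    have hXC (r : Fin l) : principal (decouple P (C 0) U) (C r.succ) = principal M (C r.succ) :=
      (principal_eq_principal_of_subset
        (Finset.subset_biUnion_of_mem (Fin.tail C) (Finset.mem_univ r)) hXU).trans (hNC r)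
    have hXdet := det_principal_decouple_union hP hP0_posDef hPU_posDef
    rw [← principal_decouple_inter P (C 0) U, ← principal_decouple_left P (C 0) U,
      ← principal_decouple_right P (C 0) U] at hXdet
    refine ⟨decouple P (C 0) U, isHermitian_decouple hP _ _, Fin.cases hX0 hXC, ?_,
      .of_tail (hNfac.of_principal_biUnion_eq hXU) hXdet⟩
    rw [biUnion_univ_succ]
    exact posDef_principal_decouple_union hP hP0_posDef hPU_posDef

end CliqueSequence

section Completion

variable {V : Type*} {G : SimpleGraph V}

namespace PartialSymMatrix

open Classical in
/-- The completion of `A` whose unspecified entries are all zero. Only its blocks on the cliques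
enter the construction of the completion with maximal determinant. -/
noncomputable def zeroFill (A : PartialSymMatrix G) : Matrix V V ℝ :=
  of fun i j => if h : i = j ∨ G.Adj i j then A.entry i j h else 0

theorem isCompletion_zeroFill (A : PartialSymMatrix G) : A.IsCompletion A.zeroFill :=
  fun _ _ h => dif_pos h

theorem isHermitian_zeroFill (A : PartialSymMatrix G) : A.zeroFill.IsHermitian := by
  refine .ext fun i j => ?_
  have hsymm : j = i ∨ G.Adj j i ↔ i = j ∨ G.Adj i j := or_congr eq_comm (G.adj_comm j i)
  by_cases h : i = j ∨ G.Adj i j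
  · simp [zeroFill, h, hsymm.2 h, A.symm i j h (hsymm.2 h)]
  · simp [zeroFill, h, hsymm.not.2 h]

theorem IsCompletion.principal_eq_block {A : PartialSymMatrix G} {X : Matrix V V ℝ}
    (hX : A.IsCompletion X) (K : Finset V) (hK : G.IsClique (K : Set V)) :
    principal X K = A.block K hK :=
  Matrix.ext fun _ _ => hX _ _ _

end PartialSymMatrix

namespace IsRunningIntersectionOrdering

variable [DecidableEq V] {l : ℕ} {C : Fin l → Finset V}

theorem exists_mem_mem [Finite V] (hC : IsRunningIntersectionOrdering G C) {i j : V}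
    (h : i = j ∨ G.Adj i j) : ∃ r, i ∈ C r ∧ j ∈ C r := by
  have hpair : G.IsClique ({i, j} : Set V) := SimpleGraph.isClique_pair.2 h.resolve_left
  obtain ⟨K, hijK, hK⟩ := (Set.toFinite {s : Set V | G.IsClique s}).exists_le_maximal hpair
  obtain ⟨r, hr⟩ := (hC.mem_iff K.toFinite.toFinset).2 (by simpa using hK)
  refine ⟨r, ?_, ?_⟩ <;> rw [hr, Set.Finite.mem_toFinset] <;> exact hijK (by simp)

theorem biUnion_univ_eq_univ [Fintype V] (hC : IsRunningIntersectionOrdering G C) :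
    Finset.univ.biUnion C = Finset.univ := by
  refine Finset.eq_univ_of_forall fun i => ?_
  obtain ⟨r, hr, -⟩ := hC.exists_mem_mem (.inl (rfl : i = i))
  exact Finset.mem_biUnion.2 ⟨r, Finset.mem_univ r, hr⟩

theorem isCompletion_of_principal_eq_block [Finite V] (hC : IsRunningIntersectionOrdering G C)
    {A : PartialSymMatrix G} {X : Matrix V V ℝ}
    (hX : ∀ r, principal X (C r) = A.block (C r) (hC.isClique r)) : A.IsCompletion X := by
  intro i j h
  obtain ⟨r, hi, hj⟩ := hC.exists_mem_mem h
  exact congrFun₂ (hX r) ⟨i, hi⟩ ⟨j, hj⟩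

theorem exists_isPosDefCompletion_detFactorizes [Finite V]
    (hC : IsRunningIntersectionOrdering G C) (A : PartialSymMatrix G)
    (hA : ∀ r, (A.block (C r) (hC.isClique r)).PosDef) :
    ∃ X : Matrix V V ℝ, A.IsPosDefCompletion X ∧ DetFactorizes X C := by
  have := Fintype.ofFinite V
  have hblock (r : Fin l) := A.isCompletion_zeroFill.principal_eq_block (C r) (hC.isClique r)
  obtain ⟨X, -, hXC, hX, hfac⟩ := exists_posDef_principal_biUnion_detFactorizes C
    A.isHermitian_zeroFill (fun r => hblock r ▸ hA r)
    fun r hr => (hC.running r hr).imp fun _ hs => ⟨hs.1, hs.2.subset⟩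
  rw [hC.biUnion_univ_eq_univ] at hX
  exact ⟨X, ⟨hC.isCompletion_of_principal_eq_block fun r => (hXC r).trans (hblock r),
    posDef_of_posDef_principal_univ hX⟩, hfac⟩

theorem eq_of_detFactorizes [Finite V] (hC : IsRunningIntersectionOrdering G C)
    {A : PartialSymMatrix G} {X Y : Matrix V V ℝ} (hX : A.IsPosDefCompletion X)
    (hY : A.IsPosDefCompletion Y) (hXfac : DetFactorizes X C) (hYfac : DetFactorizes Y C) :
    X = Y := by
  have := Fintype.ofFinite V
  refine eq_of_principal_univ_eq ?_
  rw [← hC.biUnion_univ_eq_univ]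
  exact hXfac.principal_biUnion_eq hX.2 hY.2 hYfac fun r =>
    (hX.1.principal_eq_block _ (hC.isClique r)).trans
      (hY.1.principal_eq_block _ (hC.isClique r)).symm

theorem prod_det_block_separator_pos (hC : IsRunningIntersectionOrdering G C)
    {A : PartialSymMatrix G} {X : Matrix V V ℝ} (hX : A.IsPosDefCompletion X) :
    0 < ∏ r, (A.block (separator C r) (hC.isClique_separator r)).det := by
  simpa only [hX.1.principal_eq_block _ (hC.isClique_separator _)]
    using prod_det_pos hX.2 (separator C)

theorem sum_log_det_block_separator (hC : IsRunningIntersectionOrdering G C)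
    (A : PartialSymMatrix G) :
    ∑ r with r.val + 1 < l, Real.log (A.block (separator C r) (hC.isClique_separator r)).det =
      ∑ r, Real.log (A.block (separator C r) (hC.isClique_separator r)).det := by
  refine Finset.sum_filter_of_ne fun r _ hne => ?_
  by_contra hr
  have : IsEmpty (separator C r) := Finset.isEmpty_coe_sort.2 (separator_eq_empty_of_last C hr)
  exact hne (by rw [det_isEmpty, Real.log_one])

variable [Fintype V]

theorem det_principal_biUnion_univ (hC : IsRunningIntersectionOrdering G C) (X : Matrix V V 𝕜) :
    (principal X (Finset.univ.biUnion C)).det = X.det := by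
  rw [hC.biUnion_univ_eq_univ, det_principal_univ]

theorem detFactorizes_iff (hC : IsRunningIntersectionOrdering G C) {A : PartialSymMatrix G}
    {X : Matrix V V ℝ} (hX : A.IsCompletion X) :
    DetFactorizes X C ↔
      X.det * ∏ r, (A.block (separator C r) (hC.isClique_separator r)).det =
        ∏ r, (A.block (C r) (hC.isClique r)).det := by
  simp only [DetFactorizes, hC.det_principal_biUnion_univ,
    hX.principal_eq_block _ (hC.isClique _), hX.principal_eq_block _ (hC.isClique_separator _)]

theorem det_mul_prod_det_block_separator_le (hC : IsRunningIntersectionOrdering G C)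
    {A : PartialSymMatrix G} {X : Matrix V V ℝ} (hX : A.IsPosDefCompletion X) :
    X.det * ∏ r, (A.block (separator C r) (hC.isClique_separator r)).det ≤
      ∏ r, (A.block (C r) (hC.isClique r)).det := by
  simpa only [hC.det_principal_biUnion_univ,
    hX.1.principal_eq_block _ (hC.isClique _),
    hX.1.principal_eq_block _ (hC.isClique_separator _)]
    using det_biUnion_mul_prod_det_separator_le C hX.2

theorem isMaxDetCompletion_of_detFactorizes (hC : IsRunningIntersectionOrdering G C)
    {A : PartialSymMatrix G} {X : Matrix V V ℝ} (hX : A.IsPosDefCompletion X)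
    (hfac : DetFactorizes X C) : A.IsMaxDetCompletion X := by
  refine ⟨hX, fun Y hY => le_of_mul_le_mul_right ?_ (hC.prod_det_block_separator_pos hX)⟩
  rw [(hC.detFactorizes_iff hX.1).1 hfac]
  exact hC.det_mul_prod_det_block_separator_le hY

theorem isMaxDetCompletion_iff_detFactorizes (hC : IsRunningIntersectionOrdering G C)
    {A : PartialSymMatrix G} (hA : ∀ r, (A.block (C r) (hC.isClique r)).PosDef)
    {X : Matrix V V ℝ} :
    A.IsMaxDetCompletion X ↔ A.IsPosDefCompletion X ∧ DetFactorizes X C := by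
  refine ⟨fun hX => ⟨hX.1, ?_⟩, fun hX => hC.isMaxDetCompletion_of_detFactorizes hX.1 hX.2⟩
  obtain ⟨Y, hY, hYfac⟩ := hC.exists_isPosDefCompletion_detFactorizes A hA
  have hdet : X.det = Y.det :=
    ((hC.isMaxDetCompletion_of_detFactorizes hY hYfac).2 X hX.1).antisymm (hX.2 Y hY)
  rwa [hC.detFactorizes_iff hX.1.1, hdet, ← hC.detFactorizes_iff hY.1]

theorem existsUnique_isMaxDetCompletion (hC : IsRunningIntersectionOrdering G C)
    {A : PartialSymMatrix G} (hA : ∀ r, (A.block (C r) (hC.isClique r)).PosDef) :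
    ∃! X : Matrix V V ℝ, A.IsMaxDetCompletion X := by
  simp only [hC.isMaxDetCompletion_iff_detFactorizes hA]
  obtain ⟨X, hX, hXfac⟩ := hC.exists_isPosDefCompletion_detFactorizes A hA
  exact ⟨X, ⟨hX, hXfac⟩, fun Y hY => hC.eq_of_detFactorizes hY.1 hX hY.2 hXfac⟩

theorem log_det_of_detFactorizes (hC : IsRunningIntersectionOrdering G C)
    {A : PartialSymMatrix G} {X : Matrix V V ℝ} (hX : A.IsPosDefCompletion X)
    (hfac : DetFactorizes X C) :
    Real.log X.det = ∑ r, Real.log (A.block (C r) (hC.isClique r)).det -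
      ∑ r with r.val + 1 < l, Real.log (A.block (separator C r) (hC.isClique_separator r)).det := by
  have hlog := congrArg Real.log ((hC.detFactorizes_iff hX.1).1 hfac)
  have hblock {K : Finset V} (hK : G.IsClique (K : Set V)) : (A.block K hK).det ≠ 0 := by
    rw [← hX.1.principal_eq_block K hK]
    exact (posDef_principal hX.2 K).det_pos.ne'
  rw [Real.log_mul hX.2.det_pos.ne' (hC.prod_det_block_separator_pos hX).ne',
    Real.log_prod fun r _ => hblock _, Real.log_prod fun r _ => hblock _] at hlog
  rw [hC.sum_log_det_block_separator, eq_sub_iff_add_eq, hlog]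

end IsRunningIntersectionOrdering

end Completion

end MatrixCompletion

theorem mainTheorem1 {V : Type*} [Fintype V] [DecidableEq V] (G : SimpleGraph V)
    (hG : MatrixCompletion.IsChordal G)
    {l : ℕ} (C : Fin l → Finset V)
    (hC : MatrixCompletion.IsRunningIntersectionOrdering G C)
    (A : MatrixCompletion.PartialSymMatrix G)
    (hA : ∀ r : Fin l, (A.block (C r) (hC.isClique r)).PosDef) :
    (∃! X : Matrix V V ℝ, A.IsMaxDetCompletion X) ∧
    ∀ X : Matrix V V ℝ, A.IsMaxDetCompletion X →
      Real.log X.det =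
        (∑ r : Fin l, Real.log (A.block (C r) (hC.isClique r)).det) -
        (∑ r ∈ Finset.univ.filter (fun r : Fin l => r.val + 1 < l),
          Real.log (A.block (MatrixCompletion.separator C r) (hC.isClique_separator r)).det) := by
  refine ⟨hC.existsUnique_isMaxDetCompletion hA, fun X hX => ?_⟩
  obtain ⟨hXcompl, hXfac⟩ := (hC.isMaxDetCompletion_iff_detFactorizes hA).1 hX
  exact hC.log_det_of_detFactorizes hXcompl hXfac
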